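/- Let $K\ge 1$. For $1\le k\le K$, sensor $k$ takes i.i.d. real observations $X^k_1,X^k_2,\dots$, independent across sensors (the distribution may differ from sensor to sensor), with common mean ${\sf E}[X^k_1]=\mu>0$, common variance ${\sf Var}[X^k_1]=\sigma^2$, $\sigma\ge 0$, and ${\sf E}[|X^k_1|^3]<\infty$. Put $S^k_t=X^k_1+\dots+X^k_t$ and $Z^k_t=(X^k_1)^2+\dots+(X^k_t)^2$ (so $S^k_0=Z^k_0=0$). For thresholds $\Delta^k,\Gamma^k>0$ let $\tau^k_0=\theta^k_0=0$ and, for $n\ge 1$, $$\tau^k_n=\inf\{t\ge\tau^k_{n-1}: S^k_t-S^k_{\tau^k_{n-1}}\ge\Delta^k\},\qquad \theta^k_n=\inf\{t\ge\theta^k_{n-1}: Z^k_t-Z^k_{\theta^k_{n-1}}\ge\Gamma^k\},$$ where $t$ ranges over the nonnegative integers and $\inf\emptyset=\infty$. For real $t>0$ let $N^k_t=\max\{n:\tau^k_n<t\}$, $\tau^k(t)=\tau^k_{N^k_t}$, $M^k_t=\max\{n:\theta^k_n\le t\}$, $\theta^k(t)=\theta^k_{M^k_t}$, and define $$\hat\mu_t=\frac1K\sum_{k=1}^K\frac{\Delta^kN^k_t}{\tau^k(t)},\qquad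 \hat\sigma_t=\sqrt{\frac1K\sum_{k=1}^K\frac{\Gamma^kM^k_t}{\theta^k(t)}-(\hat\mu_t)^2},$$ where $0/0:=0$ and the square root of a negative number is read as $0$. Then $\hat\sigma_t\to\sigma$ in probability as $\min_k\Gamma^k,\ \min_k\Delta^k,\ t\to\infty$ so that $\max_k\Gamma^k=o(t)$ and $\max_k\Delta^k=o(t)$. That is, the convergence holds along every family (sequence, net or filter) of thresholds and times $(\Delta^k,\Gamma^k,t)$ that satisfies these conditions. -/

import Mathlib

open MeasureTheory ProbabilityTheory Filter Asymptotics

noncomputable section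

namespace SensorEstimation

/-- The successive threshold-crossing times of a path `s : ℕ → ℝ` with threshold `d`:
`T 0 = 0` and `T (n + 1) = inf {t ≥ T n : s t - s (T n) ≥ d}`.
The value is `⊤` if the infimum is over the empty set, or if `T n = ⊤`. -/
def crossingTime (s : ℕ → ℝ) (d : ℝ) : ℕ → ℕ∞
  | 0 => 0
  | n + 1 => sInf {u : ℕ∞ | ∃ m t : ℕ,
      crossingTime s d n = (m : ℕ∞) ∧ u = (t : ℕ∞) ∧ m ≤ t ∧ d ≤ s t - s m}

/-- `max {n : T n < t}`, for a sequence of times `T` and a (real) time `t`. -/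
def countBefore (T : ℕ → ℕ∞) (t : ℝ) : ℕ :=
  sSup {n : ℕ | ∃ m : ℕ, T n = (m : ℕ∞) ∧ (m : ℝ) < t}

/-- `max {n : T n ≤ t}`, for a sequence of times `T` and a (real) time `t`. -/
def countUpTo (T : ℕ → ℕ∞) (t : ℝ) : ℕ :=
  sSup {n : ℕ | ∃ m : ℕ, T n = (m : ℕ∞) ∧ (m : ℝ) ≤ t}

/-- The partial sums `s t = x 0 + ... + x (t - 1)`: the entry `x i` is the `(i + 1)`-st
observation, so that `s t` is the sum of the first `t` observations. -/
def partialSum (x : ℕ → ℝ) (t : ℕ) : ℝ := ∑ i ∈ Finset.range t, x i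

/-- The communication times `τ n` of a sensor with observations `x` and threshold `Δ`. -/
def tau (x : ℕ → ℝ) (Δ : ℝ) : ℕ → ℕ∞ := crossingTime (partialSum x) Δ

/-- The communication times `θ n` of a sensor with observations `x` and threshold `Γ`,
which are driven by the partial sums of the squared observations. -/
def theta (x : ℕ → ℝ) (Γ : ℝ) : ℕ → ℕ∞ := crossingTime (partialSum fun i => x i ^ 2) Γ

/-- The local mean estimate `Δ * N t / τ (N t)`, with `N t = max {n : τ n < t}`. -/
def localMean (x : ℕ → ℝ) (Δ t : ℝ) : ℝ :=
  Δ * (countBefore (tau x Δ) t : ℝ) /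
    ((tau x Δ (countBefore (tau x Δ) t)).toNat : ℝ)

/-- The local second-moment estimate `Γ * M t / θ (M t)`, with `M t = max {n : θ n ≤ t}`. -/
def localSecondMoment (x : ℕ → ℝ) (Γ t : ℝ) : ℝ :=
  Γ * (countUpTo (theta x Γ) t : ℝ) /
    ((theta x Γ (countUpTo (theta x Γ) t)).toNat : ℝ)

/-- The fused mean estimate `∑ k, w k * localMean k`. -/
def muHat {K : ℕ} (w : Fin K → ℝ) (x : Fin K → ℕ → ℝ) (Δ : Fin K → ℝ) (t : ℝ) : ℝ :=
  ∑ k, w k * localMean (x k) (Δ k) t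

/-- The fused estimate of the standard deviation, with weights `w`, from the observations `x`
(`x k i` is the `(i + 1)`-st observation of sensor `k`), thresholds `Δ` and `Γ`, at time `t`. -/
def sigmaHat {K : ℕ} (w : Fin K → ℝ) (x : Fin K → ℕ → ℝ) (Δ Γ : Fin K → ℝ) (t : ℝ) : ℝ :=
  Real.sqrt ((∑ k, w k * localSecondMoment (x k) (Γ k) t) - (muHat w x Δ t) ^ 2)

end SensorEstimation

end

open MeasureTheory ProbabilityTheory Filter Asymptotics Topology

namespace SensorEstimation

/-! ### Pathwise analysis of the crossing times -/

section Deterministic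

/-! The estimator converges path by path. If crossing `N` occurs at time `a`, the sum there is `d *
N` plus `N` overshoots. Each overshoot is at most `C` plus the excess over `C` of the observation
causing it (`partialSum_crossingTime_bounds`). After division by `a`, the overshoots contribute `C /
d` times the rate, which vanishes as `d → ∞`, plus an average excess, which is small for large `C`.
So the rate has the limit of the sample averages (`tendsto_rate`), provided `a → ∞`, which `d =
o(t)` forces (`tendsto_lastCrossing`).

The strong law gives these path properties almost surely, for the observations and for their
squares. Convergence in probability along any filter then follows through a universal, countably
generated filter of parameters, on which sequences suffice. -/

theorem crossingTime_succ_eq_coe_iff {s : ℕ → ℝ} {d : ℝ} {n t : ℕ} :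
    crossingTime s d (n + 1) = (t : ℕ∞) ↔
      ∃ m : ℕ, crossingTime s d n = (m : ℕ∞) ∧ m ≤ t ∧ d ≤ s t - s m ∧
        ∀ u : ℕ, m ≤ u → u < t → s u - s m < d := by
  rw [crossingTime]
  constructor
  · intro h
    have hne : {u : ℕ∞ | ∃ m t : ℕ, crossingTime s d n = (m : ℕ∞) ∧ u = (t : ℕ∞) ∧ m ≤ t ∧
        d ≤ s t - s m}.Nonempty := by
      by_contra hc
      rw [Set.not_nonempty_iff_eq_empty] at hc
      rw [hc, sInf_empty] at h
      exact ENat.natCast_ne_top t h.symm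
    have hmem := csInf_mem hne
    rw [h] at hmem
    obtain ⟨m, t', hm, htt, hle, hd⟩ := hmem
    obtain rfl : t = t' := by exact_mod_cast htt
    refine ⟨m, hm, hle, hd, fun u hmu hut => ?_⟩
    by_contra hc
    have := sInf_le (show (u : ℕ∞) ∈ {u : ℕ∞ | ∃ m t : ℕ, crossingTime s d n = (m : ℕ∞) ∧
      u = (t : ℕ∞) ∧ m ≤ t ∧ d ≤ s t - s m} from ⟨m, u, hm, rfl, hmu, not_lt.1 hc⟩)
    rw [h] at this
    have : t ≤ u := by exact_mod_cast this
    omega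
  · rintro ⟨m, hm, hle, hd, hmin⟩
    apply le_antisymm
    · exact sInf_le ⟨m, t, hm, rfl, hle, hd⟩
    · apply le_sInf
      rintro _ ⟨m', u, hm', rfl, hmu, hdu⟩
      obtain rfl : m = m' := by exact_mod_cast hm.symm.trans hm'
      by_contra hc
      have hut : u < t := by exact_mod_cast not_le.1 hc
      exact absurd hdu (not_le.2 (hmin u hmu hut))

theorem exists_crossingTime_succ_eq {s : ℕ → ℝ} {d : ℝ} {n m : ℕ}
    (hm : crossingTime s d n = (m : ℕ∞)) {u : ℕ} (hmu : m ≤ u) (hd : d ≤ s u - s m) :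
    ∃ v : ℕ, v ≤ u ∧ crossingTime s d (n + 1) = (v : ℕ∞) := by
  have hle : crossingTime s d (n + 1) ≤ (u : ℕ∞) := by
    rw [crossingTime]
    exact sInf_le ⟨m, u, hm, rfl, hmu, hd⟩
  obtain ⟨v, hv⟩ := ENat.ne_top_iff_exists.1 (ne_top_of_le_ne_top (ENat.natCast_ne_top u) hle)
  refine ⟨v, ?_, hv.symm⟩
  rw [← hv] at hle
  exact_mod_cast hle

/-- A positive threshold forbids a crossing at the starting time, so finite crossing times strictly
increase. This bounds the counts, making their `sSup` a genuine maximum. -/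
theorem le_of_crossingTime_eq {s : ℕ → ℝ} {d : ℝ} (hd : 0 < d) {n m : ℕ}
    (hm : crossingTime s d n = (m : ℕ∞)) : n ≤ m := by
  induction n generalizing m with
  | zero => exact Nat.zero_le m
  | succ n ih =>
    obtain ⟨a, ha, hle, hda, -⟩ := crossingTime_succ_eq_coe_iff.1 hm
    have := ih ha
    have : a ≠ m := by
      rintro rfl
      linarith [sub_self (s a)]
    omega

theorem partialSum_succ (x : ℕ → ℝ) (n : ℕ) : partialSum x (n + 1) = partialSum x n + x n :=
  Finset.sum_range_succ x n

/-- The sum at the `n`-th crossing time exceeds `d * n` by the total overshoot, each overshoot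
being at most the increment at the crossing. -/
theorem partialSum_crossingTime_bounds {x : ℕ → ℝ} {d C : ℝ} (hd : 0 < d) {n a : ℕ}
    (ha : crossingTime (partialSum x) d n = (a : ℕ∞)) :
    d * n ≤ partialSum x a ∧
      partialSum x a ≤ (d + C) * n + partialSum (fun i => max (x i - C) 0) a := by
  induction n generalizing a with
  | zero =>
    obtain rfl : 0 = a := by exact_mod_cast (show (0 : ℕ∞) = a from ha)
    simp [partialSum]
  | succ n ih =>
    obtain ⟨m, hm, hle, hda, hmin⟩ := crossingTime_succ_eq_coe_iff.1 ha
    obtain ⟨h1, h2⟩ := ih hm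
    have hne : m ≠ a := by
      rintro rfl
      linarith [sub_self (partialSum x m)]
    obtain ⟨b, rfl⟩ : ∃ b, a = b + 1 := ⟨a - 1, by omega⟩
    -- One step before crossing the increment is still below `d`, so the overshoot is less than `x
    -- b`.
    have hb := hmin b (by omega) (by omega)
    have hmono : partialSum (fun i => max (x i - C) 0) m ≤
        partialSum (fun i => max (x i - C) 0) b :=
      Finset.sum_le_sum_of_subset_of_nonneg
        (Finset.range_mono (by omega)) fun _ _ _ => le_max_right _ _
    have hx : x b - C ≤ max (x b - C) 0 := le_max_left _ _
    push_cast
    constructor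
    · linarith
    · rw [partialSum_succ, partialSum_succ]
      linarith

/-- The averages of the path `x` converge to `m`, and the averages of its excesses over `C`
converge to a limit that vanishes as `C → ∞`. -/
structure HasUniformAverage (x : ℕ → ℝ) (m : ℝ) : Prop where
  average : Tendsto (fun n : ℕ => partialSum x n / n) atTop (𝓝 m)
  excess : ∃ g : ℕ → ℝ, Tendsto g atTop (𝓝 0) ∧ ∀ C : ℕ,
    Tendsto (fun n : ℕ => partialSum (fun i => max (x i - C) 0) n / n) atTop (𝓝 (g C))

variable {ι : Type*} {l : Filter ι} {x : ℕ → ℝ} {m : ℝ} {d t : ι → ℝ} {N a : ι → ℕ}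

/-- With the last crossing stuck below `b`, the sum just before `t` would be at most a constant plus
`d = o(t)`, yet it grows like `m * t`. -/
theorem HasUniformAverage.tendsto_lastCrossing (hx : HasUniformAverage x m) (hm : 0 < m)
    (ht : Tendsto t l atTop) (hdt : Tendsto (fun i => d i / t i) l (𝓝 0))
    (hlast : ∀ᶠ i in l, ∀ u : ℕ, a i ≤ u → (u : ℝ) < t i →
      partialSum x u - partialSum x (a i) < d i) :
    Tendsto a l atTop := by
  rw [tendsto_atTop]
  intro b
  obtain ⟨B, hB⟩ := ((Set.finite_lt_nat b).image (partialSum x)).bddAbove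
  obtain ⟨n₀, hn₀⟩ := eventually_atTop.1
    (hx.average.eventually (lt_mem_nhds (show m / 2 < m by linarith)))
  filter_upwards [hlast, hdt.eventually (gt_mem_nhds (show 0 < m / 4 by linarith)),
    ht.eventually_ge_atTop (n₀ + b + 2), ht.eventually_ge_atTop (4 * (B + m) / m)]
    with i hi hd hti hti'
  by_contra hc
  rw [not_le] at hc
  have hn₀' : (0 : ℝ) ≤ n₀ := Nat.cast_nonneg n₀
  have hb' : (0 : ℝ) ≤ b := Nat.cast_nonneg b
  have htpos : 0 < t i := by linarith
  rw [div_lt_iff₀ htpos] at hd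
  rw [div_le_iff₀ hm] at hti'
  have hceil : t i ≤ (⌈t i⌉₊ : ℝ) := Nat.le_ceil _
  have hceil' := Nat.ceil_lt_add_one htpos.le
  have hge : n₀ + b + 2 ≤ ⌈t i⌉₊ := by
    exact_mod_cast hti.trans hceil
  -- `u` is the last integer strictly before `t i`. The contradiction is `m * (t - 1) / 2 < B + m *
  -- t / 4` against `m * t / 4 ≥ B + m`.
  obtain ⟨u, hu⟩ : ∃ u, ⌈t i⌉₊ = u + 1 := ⟨⌈t i⌉₊ - 1, by omega⟩
  rw [hu] at hceil hceil' hge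
  push_cast at hceil hceil'
  have h1 := hi u (by omega) (by linarith)
  have h2 := hn₀ u (by omega)
  have hupos : (0 : ℝ) < u := by exact_mod_cast (show 0 < u by omega)
  rw [lt_div_iff₀ hupos] at h2
  have h3 : partialSum x (a i) ≤ B := hB ⟨a i, hc, rfl⟩
  nlinarith

theorem HasUniformAverage.tendsto_rate (hx : HasUniformAverage x m)
    (hd : Tendsto d l atTop) (ha : Tendsto a l atTop)
    (hN : ∀ᶠ i in l, crossingTime (partialSum x) (d i) (N i) = (a i : ℕ∞)) :
    Tendsto (fun i => d i * N i / a i) l (𝓝 m) := by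
  obtain ⟨g, hg, hgC⟩ := hx.excess
  have hs : Tendsto (fun i => partialSum x (a i) / a i) l (𝓝 m) := hx.average.comp ha
  rw [Metric.tendsto_nhds]
  intro ε hε
  -- `C` is fixed before `d` grows, so that `C / d → 0`.
  obtain ⟨C, hC⟩ := (hg.eventually (gt_mem_nhds (show 0 < ε / 4 by linarith))).exists
  have hCd : Tendsto (fun i => (C : ℝ) / d i) l (𝓝 0) := tendsto_const_nhds.div_atTop hd
  have hCd' : Tendsto (fun i => (m + 1) * ((C : ℝ) / d i)) l (𝓝 0) := by
    simpa using hCd.const_mul (m + 1)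
  filter_upwards [hN, hd.eventually_gt_atTop 0, ha.eventually_gt_atTop 0,
    hs.eventually (gt_mem_nhds (show m < m + ε / 4 by linarith)),
    hs.eventually (gt_mem_nhds (show m < m + 1 by linarith)),
    hs.eventually (lt_mem_nhds (show m - ε / 4 < m by linarith)),
    ((hgC C).comp ha).eventually (gt_mem_nhds hC),
    hCd'.eventually (gt_mem_nhds (show 0 < ε / 4 by linarith))]
    with i hNi hdi hai h1 h2 h3 h4 h5
  have hapos : (0 : ℝ) < a i := by exact_mod_cast hai
  obtain ⟨hlo, hhi⟩ := partialSum_crossingTime_bounds (C := C) hdi hNi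
  have hlo' := div_le_div_of_nonneg_right hlo hapos.le
  have hhi' := div_le_div_of_nonneg_right hhi hapos.le
  have hsplit : ((d i + C) * N i + partialSum (fun j => max (x j - C) 0) (a i)) / a i =
      d i * N i / a i + (d i * N i / a i) * (C / d i) +
        partialSum (fun j => max (x j - C) 0) (a i) / a i := by
    field_simp
  rw [hsplit] at hhi'
  have hmul : (d i * N i / a i) * (C / d i) ≤ (m + 1) * (C / d i) :=
    mul_le_mul_of_nonneg_right (by linarith) (by positivity)
  simp only [Function.comp_apply] at h4
  rw [Real.dist_eq, abs_lt]
  constructor <;> linarith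

/-- The predicate `p` covers both conventions, `< t` and `≤ t`. A further crossing at an admissible
time would contradict maximality. -/
theorem crossingTime_sSup_spec {s : ℕ → ℝ} {d : ℝ} (hd : 0 < d) {p : ℕ → Prop} (h0 : p 0)
    {b : ℕ} (hb : ∀ u, p u → u ≤ b) :
    ∃ a : ℕ, crossingTime s d (sSup {n | ∃ m : ℕ, crossingTime s d n = (m : ℕ∞) ∧ p m}) =
        (a : ℕ∞) ∧
      ∀ u : ℕ, a ≤ u → (∀ v ≤ u, p v) → s u - s a < d := by
  set A : Set ℕ := {n | ∃ m : ℕ, crossingTime s d n = (m : ℕ∞) ∧ p m} with hA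
  have hbdd : BddAbove A := by
    refine ⟨b, ?_⟩
    rintro n ⟨k, hk, hpk⟩
    exact (le_of_crossingTime_eq hd hk).trans (hb k hpk)
  obtain ⟨a, ha, -⟩ : sSup A ∈ A := Nat.sSup_mem ⟨0, 0, rfl, h0⟩ hbdd
  refine ⟨a, ha, fun u hau hpu => ?_⟩
  by_contra hc
  obtain ⟨v, hvu, hv⟩ := exists_crossingTime_succ_eq ha hau (not_lt.1 hc)
  have := le_csSup hbdd (show sSup A + 1 ∈ A from ⟨v, hv, hpu v hvu⟩)
  omega

theorem HasUniformAverage.tendsto_rate_sSup (hx : HasUniformAverage x m) (hm : 0 < m)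
    (hd : Tendsto d l atTop) (ht : Tendsto t l atTop)
    (hdt : Tendsto (fun i => d i / t i) l (𝓝 0)) {p : ι → ℕ → Prop}
    (hlt : ∀ i (u : ℕ), (u : ℝ) < t i → p i u) (hle : ∀ i (u : ℕ), p i u → (u : ℝ) ≤ t i)
    (hN : ∀ i, N i = sSup {n | ∃ k : ℕ,
      crossingTime (partialSum x) (d i) n = (k : ℕ∞) ∧ p i k}) :
    Tendsto (fun i => d i * N i /
      ((crossingTime (partialSum x) (d i) (N i)).toNat : ℝ)) l (𝓝 m) := by
  have key : ∀ᶠ i in l, crossingTime (partialSum x) (d i) (N i) =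
      ((crossingTime (partialSum x) (d i) (N i)).toNat : ℕ∞) ∧
      ∀ u : ℕ, (crossingTime (partialSum x) (d i) (N i)).toNat ≤ u → (u : ℝ) < t i →
        partialSum x u - partialSum x (crossingTime (partialSum x) (d i) (N i)).toNat < d i := by
    filter_upwards [hd.eventually_gt_atTop 0, ht.eventually_gt_atTop 0] with i hdi hti
    obtain ⟨a, ha, hlast⟩ := crossingTime_sSup_spec (s := partialSum x) hdi (p := p i)
      (hlt i 0 (by simpa using hti)) (b := ⌊t i⌋₊) fun u hu => Nat.le_floor (hle i u hu)
    rw [← hN] at ha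
    simp only [ha, ENat.toNat_natCast, true_and]
    exact fun u hau hut => hlast u hau fun v hv =>
      hlt i v (lt_of_le_of_lt (by exact_mod_cast hv) hut)
  exact hx.tendsto_rate hd
    (hx.tendsto_lastCrossing hm ht hdt (key.mono fun i hi => hi.2)) (key.mono fun i hi => hi.1)

theorem HasUniformAverage.tendsto_localMean (hx : HasUniformAverage x m) (hm : 0 < m)
    (hd : Tendsto d l atTop) (ht : Tendsto t l atTop)
    (hdt : Tendsto (fun i => d i / t i) l (𝓝 0)) :
    Tendsto (fun i => localMean x (d i) (t i)) l (𝓝 m) :=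
  hx.tendsto_rate_sSup hm hd ht hdt (p := fun i u => (u : ℝ) < t i) (fun _ _ h => h)
    (fun _ _ h => h.le) fun _ => rfl

theorem HasUniformAverage.tendsto_localSecondMoment
    (hx : HasUniformAverage (fun i => x i ^ 2) m) (hm : 0 < m)
    (hd : Tendsto d l atTop) (ht : Tendsto t l atTop)
    (hdt : Tendsto (fun i => d i / t i) l (𝓝 0)) :
    Tendsto (fun i => localSecondMoment x (d i) (t i)) l (𝓝 m) :=
  hx.tendsto_rate_sSup hm hd ht hdt (p := fun i u => (u : ℝ) ≤ t i) (fun _ _ h => h.le)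
    (fun _ _ h => h) fun _ => rfl

theorem tendsto_sigmaHat {K : ℕ} (hK : 0 < K) {x : Fin K → ℕ → ℝ} {μ σ : ℝ} (hμ : 0 < μ)
    (hσ : 0 ≤ σ) (hx : ∀ k, HasUniformAverage (x k) μ)
    (hx2 : ∀ k, HasUniformAverage (fun i => x k i ^ 2) (μ ^ 2 + σ ^ 2))
    {Δ Γ : ι → Fin K → ℝ}
    (hΔ : ∀ k, Tendsto (fun i => Δ i k) l atTop) (hΓ : ∀ k, Tendsto (fun i => Γ i k) l atTop)
    (ht : Tendsto t l atTop)
    (hΔt : ∀ k, Tendsto (fun i => Δ i k / t i) l (𝓝 0))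
    (hΓt : ∀ k, Tendsto (fun i => Γ i k / t i) l (𝓝 0)) :
    Tendsto (fun i => sigmaHat (fun _ => 1 / (K : ℝ)) x (Δ i) (Γ i) (t i)) l (𝓝 σ) := by
  have hK' : (K : ℝ) ≠ 0 := by exact_mod_cast hK.ne'
  have average {f : Fin K → ι → ℝ} {c : ℝ} (hf : ∀ k, Tendsto (f k) l (𝓝 c)) :
      Tendsto (fun i => ∑ k, 1 / (K : ℝ) * f k i) l (𝓝 c) := by
    have h := tendsto_finsetSum Finset.univ fun k _ => (hf k).const_mul (1 / (K : ℝ))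
    have hc : ∑ _k : Fin K, 1 / (K : ℝ) * c = c := by
      simp [hK']
    rwa [hc] at h
  have h1 := average fun k => (hx k).tendsto_localMean hμ (hΔ k) ht (hΔt k)
  have h2 := average fun k => (hx2 k).tendsto_localSecondMoment (by positivity) (hΓ k) ht (hΓt k)
  have h3 := (Real.continuous_sqrt.tendsto _).comp (h2.sub (h1.pow 2))
  rwa [add_sub_cancel_left, Real.sqrt_sq hσ] at h3

end Deterministic

/-! ### Measurability of the estimator -/

section Measurability

variable {Ω : Type*} [MeasurableSpace Ω]

theorem measurableSet_crossingTime_eq {s : Ω → ℕ → ℝ} (hs : ∀ n, Measurable fun ω => s ω n)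
    (d : ℝ) (n t : ℕ) : MeasurableSet {ω | crossingTime (s ω) d n = (t : ℕ∞)} := by
  induction n generalizing t with
  | zero => exact MeasurableSet.const ((0 : ℕ∞) = t)
  | succ n ih =>
    have : {ω | crossingTime (s ω) d (n + 1) = (t : ℕ∞)} =
        ⋃ m : ℕ, {ω | crossingTime (s ω) d n = (m : ℕ∞)} ∩ ({_ω | m ≤ t} ∩
          ({ω | d ≤ s ω t - s ω m} ∩
            ⋂ u : ℕ, ⋂ _ : m ≤ u, ⋂ _ : u < t, {ω | s ω u - s ω m < d})) := by
      ext ω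
      simp [crossingTime_succ_eq_coe_iff]
    rw [this]
    exact .iUnion fun m => (ih m).inter <| .inter (.const _) <|
      .inter (measurableSet_le measurable_const ((hs t).sub (hs m))) <|
      .iInter fun u => .iInter fun _ => .iInter fun _ =>
        measurableSet_lt ((hs u).sub (hs m)) measurable_const

theorem measurable_toNat_crossingTime {s : Ω → ℕ → ℝ} (hs : ∀ n, Measurable fun ω => s ω n)
    (d : ℝ) (n : ℕ) : Measurable fun ω => (crossingTime (s ω) d n).toNat := by
  -- The value `0` is avoided because `toNat` also sends `⊤` to `0`.
  have hpos (c : ℕ) (hc : c ≠ 0) :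
      MeasurableSet ((fun ω => (crossingTime (s ω) d n).toNat) ⁻¹' {c}) := by
    convert measurableSet_crossingTime_eq hs d n c using 1
    ext ω
    simp only [Set.mem_preimage, Set.mem_singleton_iff, Set.mem_ofPred_eq]
    exact ENat.toNat_eq_iff hc
  refine measurable_of_Ioi fun c => ?_
  have : (fun ω => (crossingTime (s ω) d n).toNat) ⁻¹' Set.Ioi c =
      ⋃ b : ℕ, ⋃ _ : c < b, (fun ω => (crossingTime (s ω) d n).toNat) ⁻¹' {b} := by
    ext ω
    simp
  rw [this]
  exact .iUnion fun b => .iUnion fun hb => hpos b (by omega)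

theorem measurable_nat_sSup {A : ℕ → Set Ω} (hA : ∀ n, MeasurableSet (A n)) :
    Measurable fun ω => sSup {n | ω ∈ A n} := by
  refine measurable_of_Iic fun c => ?_
  -- The second piece is the event that the set is unbounded, where `sSup` is `0` by convention.
  have : (fun ω => sSup {n | ω ∈ A n}) ⁻¹' Set.Iic c =
      (⋂ n, ⋂ _ : c < n, (A n)ᶜ) ∪ (⋃ b : ℕ, ⋂ n, ⋂ _ : b < n, (A n)ᶜ)ᶜ := by
    ext ω
    have hbdd : ω ∈ (⋃ b : ℕ, ⋂ n, ⋂ _ : b < n, (A n)ᶜ) ↔ BddAbove {n | ω ∈ A n} := by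
      simp only [Set.mem_iUnion, Set.mem_iInter, Set.mem_compl_iff, BddAbove, Set.Nonempty,
        mem_upperBounds, Set.mem_ofPred_eq]
      exact exists_congr fun b => forall_congr' fun n => by
        rw [← not_lt]
        tauto
    rw [Set.mem_union, Set.mem_compl_iff, hbdd]
    simp only [Set.mem_preimage, Set.mem_Iic, Set.mem_iInter, Set.mem_compl_iff]
    constructor
    · intro h
      by_cases hb : BddAbove {n | ω ∈ A n}
      · exact .inl fun n hn hmem => absurd (le_csSup hb hmem) (by omega)
      · exact .inr hb
    · rintro (h | h)
      · exact csSup_le' fun n hn => not_lt.1 fun hc => h n hc hn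
      · rw [Nat.sSup_of_not_bddAbove h]
        exact Nat.zero_le c
  rw [this]
  have hc (b : ℕ) : MeasurableSet (⋂ n, ⋂ _ : b < n, (A n)ᶜ) :=
    .iInter fun n => .iInter fun _ => (hA n).compl
  exact (hc c).union (MeasurableSet.iUnion hc).compl

theorem measurable_rate_sSup {s : Ω → ℕ → ℝ} (hs : ∀ n, Measurable fun ω => s ω n)
    (d : ℝ) (p : ℕ → Prop) {N : Ω → ℕ}
    (hN : ∀ ω, N ω = sSup {n | ∃ m : ℕ, crossingTime (s ω) d n = (m : ℕ∞) ∧ p m}) :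
    Measurable fun ω => d * (N ω : ℝ) / ((crossingTime (s ω) d (N ω)).toNat : ℝ) := by
  have hNm : Measurable N := by
    rw [funext hN]
    refine measurable_nat_sSup
      (A := fun n => {ω | ∃ m : ℕ, crossingTime (s ω) d n = (m : ℕ∞) ∧ p m}) fun n => ?_
    have : {ω | ∃ m : ℕ, crossingTime (s ω) d n = (m : ℕ∞) ∧ p m} =
        ⋃ m : ℕ, {ω | crossingTime (s ω) d n = (m : ℕ∞)} ∩ {_ω | p m} := by
      ext ω
      simp
    rw [this]
    exact .iUnion fun m => (measurableSet_crossingTime_eq hs d n m).inter (.const (p m))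
  have hT : Measurable fun ω => (crossingTime (s ω) d (N ω)).toNat :=
    (measurable_from_prod_countable_right (f := fun q : ℕ × Ω => (crossingTime (s q.2) d q.1).toNat)
      fun n => measurable_toNat_crossingTime hs d n).comp (hNm.prodMk measurable_id)
  exact (((measurable_from_nat (f := fun n : ℕ => (n : ℝ))).comp hNm).const_mul d).div
    ((measurable_from_nat (f := fun n : ℕ => (n : ℝ))).comp hT)

theorem measurable_partialSum {x : ℕ → Ω → ℝ} (hx : ∀ n, Measurable (x n)) (n : ℕ) :
    Measurable fun ω => partialSum (fun i => x i ω) n :=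
  Finset.measurable_fun_sum _ fun i _ => hx i

theorem measurable_sigmaHat {K : ℕ} (w : Fin K → ℝ) {X : Fin K → ℕ → Ω → ℝ}
    (hX : ∀ k n, Measurable (X k n)) (Δ Γ : Fin K → ℝ) (t : ℝ) :
    Measurable fun ω => sigmaHat w (fun k n => X k n ω) Δ Γ t := by
  have h1 (k : Fin K) : Measurable fun ω => localMean (fun n => X k n ω) (Δ k) t :=
    measurable_rate_sSup (measurable_partialSum (hX k)) (Δ k) (fun m => (m : ℝ) < t) fun _ => rfl
  have h2 (k : Fin K) : Measurable fun ω => localSecondMoment (fun n => X k n ω) (Γ k) t :=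
    measurable_rate_sSup (measurable_partialSum fun n => (hX k n).pow_const 2) (Γ k)
      (fun m => (m : ℝ) ≤ t) fun _ => rfl
  exact ((Finset.measurable_fun_sum _ fun k _ => (h2 k).const_mul (w k)).sub
    ((Finset.measurable_fun_sum _ fun k _ => (h1 k).const_mul (w k)).pow_const 2)).sqrt

end Measurability

/-! ### Strong law and convergence in probability -/

section Probability

variable {Ω : Type*} [MeasurableSpace Ω] {P : Measure Ω}

/-- The strong law applies to `Y` and, for the countably many `C`, to the excesses, whose means
vanish by dominated convergence. -/
theorem ae_hasUniformAverage {Y : ℕ → Ω → ℝ}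
    (hint : Integrable (Y 0) P) (hindep : Pairwise fun i j => Y i ⟂ᵢ[P] Y j)
    (hident : ∀ n, IdentDistrib (Y n) (Y 0) P P) :
    ∀ᵐ ω ∂P, HasUniformAverage (fun n => Y n ω) (∫ ω, Y 0 ω ∂P) := by
  have hmeas (C : ℕ) : Measurable fun y : ℝ => max (y - C) 0 := by fun_prop
  have hexc (C : ℕ) : Integrable (fun ω => max (Y 0 ω - C) 0) P := by
    refine hint.norm.mono' ((hmeas C).comp_aemeasurable hint.aemeasurable).aestronglyMeasurable ?_
    filter_upwards with ω
    have : (0 : ℝ) ≤ C := Nat.cast_nonneg C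
    rw [Real.norm_of_nonneg (le_max_right _ _)]
    exact max_le (by linarith [Real.le_norm_self (Y 0 ω)]) (norm_nonneg _)
  have hlim : Tendsto (fun C : ℕ => ∫ ω, max (Y 0 ω - C) 0 ∂P) atTop (𝓝 0) := by
    suffices h : Tendsto (fun C : ℕ => ∫ ω, max (Y 0 ω - C) 0 ∂P) atTop
        (𝓝 (∫ _ω : Ω, (0 : ℝ) ∂P)) by simpa using h
    refine tendsto_integral_of_dominated_convergence (fun ω => ‖Y 0 ω‖)
      (fun C => (hexc C).aestronglyMeasurable) hint.norm (fun C => ?_) ?_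
    · filter_upwards with ω
      have : (0 : ℝ) ≤ C := Nat.cast_nonneg C
      rw [Real.norm_of_nonneg (le_max_right _ _)]
      exact max_le (by linarith [Real.le_norm_self (Y 0 ω)]) (norm_nonneg _)
    · filter_upwards with ω
      refine tendsto_const_nhds.congr' ?_
      filter_upwards [tendsto_natCast_atTop_atTop.eventually_ge_atTop (Y 0 ω)] with C hC
      rw [max_eq_right (by linarith)]
  have hslln (C : ℕ) := strong_law_ae_real (fun n ω => max (Y n ω - C) 0) (hexc C)
    (fun i j hij => (hindep hij).comp (hmeas C) (hmeas C)) fun n => (hident n).comp (hmeas C)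
  filter_upwards [strong_law_ae_real Y hint hindep hident, ae_all_iff.2 hslln] with ω h1 h2
  exact ⟨h1, _, hlim, h2⟩

/-- The parameters `(Δ, Γ, t)` with `min Δ, min Γ, t → ∞` and `max Δ, max Γ = o(t)`. -/
noncomputable def parameterFilter (K : ℕ) : Filter ((Fin K → ℝ) × (Fin K → ℝ) × ℝ) :=
  comap (fun p => ((⨅ k, p.1 k, ⨅ k, p.2.1 k), p.2.2,
      ((⨆ k, p.1 k) / p.2.2, (⨆ k, p.2.1 k) / p.2.2)))
    ((atTop ×ˢ atTop) ×ˢ atTop ×ˢ (𝓝 0 ×ˢ 𝓝 0))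

instance (K : ℕ) : (parameterFilter K).IsCountablyGenerated := by
  unfold parameterFilter
  infer_instance

theorem tendsto_parameterFilter {K : ℕ} {ι : Type*} {l : Filter ι}
    {p : ι → (Fin K → ℝ) × (Fin K → ℝ) × ℝ} :
    Tendsto p l (parameterFilter K) ↔
      (Tendsto (fun i => ⨅ k, (p i).1 k) l atTop ∧ Tendsto (fun i => ⨅ k, (p i).2.1 k) l atTop) ∧
      Tendsto (fun i => (p i).2.2) l atTop ∧
      Tendsto (fun i => (⨆ k, (p i).1 k) / (p i).2.2) l (𝓝 0) ∧
      Tendsto (fun i => (⨆ k, (p i).2.1 k) / (p i).2.2) l (𝓝 0) := by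
  simp only [parameterFilter, tendsto_comap_iff, tendsto_prod_iff']
  rfl

theorem tendsto_apply_of_tendsto_iInf {K : ℕ} {ι : Type*} {l : Filter ι} {D : ι → Fin K → ℝ}
    (h : Tendsto (fun i => ⨅ k, D i k) l atTop) (k : Fin K) : Tendsto (fun i => D i k) l atTop :=
  tendsto_atTop_mono (fun i => ciInf_le (Set.finite_range (D i)).bddBelow k) h

theorem tendsto_apply_div_of_tendsto_iSup {K : ℕ} {ι : Type*} {l : Filter ι} {D : ι → Fin K → ℝ}
    {t : ι → ℝ} (h : Tendsto (fun i => ⨅ k, D i k) l atTop) (ht : Tendsto t l atTop)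
    (hD : Tendsto (fun i => (⨆ k, D i k) / t i) l (𝓝 0)) (k : Fin K) :
    Tendsto (fun i => D i k / t i) l (𝓝 0) := by
  refine tendsto_of_tendsto_of_tendsto_of_le_of_le' tendsto_const_nhds hD ?_ ?_
  · filter_upwards [(tendsto_apply_of_tendsto_iInf h k).eventually_ge_atTop 0,
      ht.eventually_ge_atTop 0] with i h1 h2
    exact div_nonneg h1 h2
  · filter_upwards [ht.eventually_ge_atTop 0] with i h2
    exact div_le_div_of_nonneg_right (le_ciSup (Set.finite_range (D i)).bddAbove k) h2

theorem tendstoInMeasure_comp {α ι E : Type*} [EDist E] {f : α → Ω → E} {g : Ω → E} {u : Filter α}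
    {l : Filter ι} {p : ι → α} (h : TendstoInMeasure P f u g) (hp : Tendsto p l u) :
    TendstoInMeasure P (fun i => f (p i)) l g :=
  fun ε hε => (h ε hε).comp hp

/-- Almost sure convergence yields convergence in measure along sequences, not along general
filters; countable generation of `parameterFilter` reduces the claim to sequences. -/
theorem tendstoInMeasure_parameterFilter [IsFiniteMeasure P] {K : ℕ} (hK : 0 < K)
    {X : Fin K → ℕ → Ω → ℝ} (hmeas : ∀ k n, Measurable (X k n)) {μ σ : ℝ} (hμ : 0 < μ)
    (hσ : 0 ≤ σ) (hX : ∀ᵐ ω ∂P, ∀ k, HasUniformAverage (fun n => X k n ω) μ)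
    (hX2 : ∀ᵐ ω ∂P, ∀ k, HasUniformAverage (fun n => X k n ω ^ 2) (μ ^ 2 + σ ^ 2)) :
    TendstoInMeasure P (fun (p : (Fin K → ℝ) × (Fin K → ℝ) × ℝ) ω =>
      sigmaHat (fun _ => 1 / (K : ℝ)) (fun k n => X k n ω) p.1 p.2.1 p.2.2)
      (parameterFilter K) (fun _ => σ) := by
  intro ε hε
  refine tendsto_of_seq_tendsto fun p hp => ?_
  obtain ⟨⟨hΔ, hΓ⟩, ht, hΔt, hΓt⟩ := tendsto_parameterFilter.1 hp
  refine tendstoInMeasure_of_tendsto_ae (f := fun n ω =>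
    sigmaHat (fun _ => 1 / (K : ℝ)) (fun k n => X k n ω) (p n).1 (p n).2.1 (p n).2.2)
    (fun n => (measurable_sigmaHat _ hmeas _ _ _).aestronglyMeasurable) ?_ ε hε
  filter_upwards [hX, hX2] with ω h1 h2
  exact tendsto_sigmaHat hK hμ hσ h1 h2 (tendsto_apply_of_tendsto_iInf hΔ)
    (tendsto_apply_of_tendsto_iInf hΓ) ht (tendsto_apply_div_of_tendsto_iSup hΔ ht hΔt)
    (tendsto_apply_div_of_tendsto_iSup hΓ ht hΓt)

end Probability

end SensorEstimation

theorem mainTheorem11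
    {Ω : Type*} [MeasurableSpace Ω] (P : Measure Ω) [IsProbabilityMeasure P]
    (K : ℕ) (hK : 0 < K)
    (X : Fin K → ℕ → Ω → ℝ)
    (hmeas : ∀ k n, Measurable (X k n))
    -- all observations are independent, within each sensor and across sensors
    (hindep : iIndepFun (fun p : Fin K × ℕ => X p.1 p.2) P)
    -- at each sensor they are identically distributed
    (hident : ∀ k n, IdentDistrib (X k n) (X k 0) P P)
    (μ σ : ℝ) (hμ : 0 < μ) (hσ : 0 ≤ σ)
    (hmoment : ∀ k, Integrable (fun ω => |X k 0 ω| ^ 3) P)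
    (hmean : ∀ k, ∫ ω, X k 0 ω ∂P = μ)
    (hvar : ∀ k, variance (X k 0) P = σ ^ 2)
    -- thresholds and time along an arbitrary filter
    {ι : Type*} (l : Filter ι) (Δ Γ : ι → Fin K → ℝ) (t : ι → ℝ)
    (hΔ : Tendsto (fun i => ⨅ k, Δ i k) l atTop)
    (hΓ : Tendsto (fun i => ⨅ k, Γ i k) l atTop)
    (ht : Tendsto t l atTop)
    (hΔt : (fun i => ⨆ k, Δ i k) =o[l] t)
    (hΓt : (fun i => ⨆ k, Γ i k) =o[l] t) :
    TendstoInMeasure P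
      (fun i ω => SensorEstimation.sigmaHat (fun _ => 1 / (K : ℝ)) (fun k n => X k n ω)
        (Δ i) (Γ i) (t i))
      l (fun _ => σ) := by

  have hX (k : Fin K) : MemLp (X k 0) 2 P := by
    have h3 : MemLp (X k 0) 3 P := by
      rw [← integrable_norm_rpow_iff (hmeas k 0).aestronglyMeasurable (by norm_num) (by norm_num)]
      simpa using hmoment k
    exact h3.mono_exponent (by norm_num)
  have hind (k : Fin K) : Pairwise fun i j => X k i ⟂ᵢ[P] X k j := fun i j hij =>
    hindep.indepFun (i := (k, i)) (j := (k, j)) fun h => hij (Prod.ext_iff.1 h).2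
  have hsq : Measurable fun y : ℝ => y ^ 2 := measurable_id.pow_const 2
  have hmean2 (k : Fin K) : ∫ ω, X k 0 ω ^ 2 ∂P = μ ^ 2 + σ ^ 2 := by
    have h := variance_eq_sub (hX k)
    rw [hvar k, hmean k] at h
    simp only [Pi.pow_apply] at h
    linarith
  have h1 : ∀ᵐ ω ∂P, ∀ k, SensorEstimation.HasUniformAverage (fun n => X k n ω) μ := by
    refine ae_all_iff.2 fun k => ?_
    rw [← hmean k]
    exact SensorEstimation.ae_hasUniformAverage ((hX k).integrable (by norm_num)) (hind k)
      (hident k)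
  have h2 : ∀ᵐ ω ∂P, ∀ k,
      SensorEstimation.HasUniformAverage (fun n => X k n ω ^ 2) (μ ^ 2 + σ ^ 2) := by
    refine ae_all_iff.2 fun k => ?_
    rw [← hmean2 k]
    exact SensorEstimation.ae_hasUniformAverage (Y := fun n ω => X k n ω ^ 2) (hX k).integrable_sq
      (fun i j hij => (hind k hij).comp hsq hsq) fun n => (hident k n).comp hsq
  -- `l` itself need not be countably generated, so the limit is pulled back from `parameterFilter`.
  have hp : Tendsto (fun i => (Δ i, Γ i, t i)) l (SensorEstimation.parameterFilter K) :=
    SensorEstimation.tendsto_parameterFilter.2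
      ⟨⟨hΔ, hΓ⟩, ht, hΔt.tendsto_div_nhds_zero, hΓt.tendsto_div_nhds_zero⟩
  have h3 := SensorEstimation.tendstoInMeasure_comp
    (SensorEstimation.tendstoInMeasure_parameterFilter hK hmeas hμ hσ h1 h2) hp
  exact h3
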